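/- Consider one user whose channel succeeds in each time slot, independently, with probability $\rho\in(0,1]$, and whose source $X$ is a Markov chain that in each slot moves to the next state with probability $p\in(0,1]$ and otherwise stays; the distance between consecutive states is $d>0$. Let $j\ge 0$ be the number of slots since the generation time $g$ of the last delivered packet: if the user is scheduled (active) and the channel succeeds, $j$ is reset to $0$; otherwise $j$ becomes $j+1$. In the state $j$ the penalty is, for the age of information (AoI), $c^j=j$, and, for the distance-based age of incorrect information (AoII), $b^j=\mathbb{E}\sum_{u=g}^{g+j}[X(u)-X(g)]\,d$. For a real charge $W$ per scheduling, consider the problem of minimizing, over all causal policies, the long-run average cost $\limsup_{T\to\infty}\frac1T\mathbb{E}\sum_{t=0}^{T-1}(s(t)+Wa(t))$, where $s(t)$ is the penalty and $a(t)\in\{0,1\}$ the action at time $t$. Let $D(W)$ be the set of states in which the passive action $a=0$ is optimal, i.e. attains the minimum in the Bellman equation $$\theta+V(j)=\min\{s_j+V(j+1),\; s_j+W+\rho V(0)+(1-\rho)V(j+1)\},$$ where $s_j$ is the penalty in the state $j$, $\theta$ is the optimal average cost (the same from every initial state) and $V$ is bounded below. Then, for each of the two penalties, the problem is indexable ($W'<W$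 implies $D(W')\subseteq D(W)$), and the Whittle index of the state $n\ge0$, i.e. the minimum of all $W$ for which the state $n$ belongs to $D(W)$, exists and equals - for AoI: $\displaystyle W(c^n)=\frac{n(n+1)\rho}{2}+n+1$; - for AoII: $\displaystyle W(b^n)=d\,p\Big[\frac13\rho n^3+\Big(1+\frac{\rho}{2}\Big)n^2+\Big(1+\frac{\rho}{6}+\frac1\rho\Big)n+\frac1\rho\Big]$. If $\rho<1$, the same holds with $D(W)$ replaced by the set of states in which some stationary deterministic policy that is average-cost optimal, among all causal policies and from every initial state, takes the passive action. Moreover, in both cases, if $\overline{s^n}$ and $\overline{a^n}$ denote the long-run average penalty and the long-run average active time (both as $\limsup$) under the threshold policy $n$ (passive in the states $j<n$, active in the states $j\ge n$), then, from every initial state, $W$ equal to the index of the state $n$ is the only solution of $\overline{s^{n}}+W\,\overline{a^{n}}=\overline{s^{n+1}}+W\,\overline{a^{n+1}}$, and the index is strictly increasing in $n$. -/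

import Mathlib

open Filter

noncomputable section

namespace WhittleAge

/-! ### Elementary probability on countable sets -/

/-- The law of a Bernoulli trial with success probability `r`. -/
def coin (r : unitInterval) : PMF Bool :=
  PMF.ofFintype
    (fun c => if c then ENNReal.ofReal (r : ℝ) else ENNReal.ofReal (1 - (r : ℝ)))
    (by
      have h : ENNReal.ofReal (r : ℝ) + ENNReal.ofReal (1 - (r : ℝ)) = 1 := by
        rw [← ENNReal.ofReal_add r.2.1 (sub_nonneg.2 r.2.2)]
        simp
      simpa using h)

/-- The expectation of a real function `f` under a law `q`. It is only used below for laws `q`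
with finite support, so that the sum is a finite sum. -/
def expect {α : Type} (q : PMF α) (f : α → ℝ) : ℝ :=
  ∑' x, (q x).toReal * f x

/-! ### The two penalty functions, as functions of the time `j` since the last delivery -/

/-- The age of information, `j` slots after the generation of the last delivered packet. -/
def aoi (j : ℕ) : ℝ := j

/-- The law of `X (g + u) - X g`, where `X` is the Markov source that in each slot moves to the
next state with probability `p` and stays where it is with probability `1 - p`. -/
def sourceDisplacement (p : unitInterval) : ℕ → PMF ℕ
  | 0 => PMF.pure 0
  | u + 1 => (sourceDisplacement p u).bind fun x =>
      (coin p).map fun move => if move then x + 1 else x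

/-- The distance-based age of incorrect information, `j` slots after the generation `g` of the
last delivered packet: the expectation of `∑ u ∈ [g, g + j], (X u - X g) * d`. -/
def aoii (p : unitInterval) (d : ℝ) (j : ℕ) : ℝ :=
  ∑ u ∈ Finset.range (j + 1), expect (sourceDisplacement p u) fun x => (x : ℝ) * d

/-! ### The one-user problem

The state with index `j` has penalty `b j`. The action `true` (active) schedules the user, the
action `false` (passive) does not. -/

/-- The transition law: if the user is scheduled and the channel succeeds, the next state is `0`;
otherwise the state `j` is followed by `j + 1`. -/
def step (ρ : unitInterval) (j : ℕ) (a : Bool) : PMF ℕ :=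
  (coin ρ).map fun success => if a && success then 0 else j + 1

/-- A causal (history-dependent, possibly randomized) scheduling policy: from the list of the
past states and actions (the most recent first) and the current state it determines the law of
the next action. -/
abbrev Policy : Type := List (ℕ × Bool) → ℕ → PMF Bool

/-- The stationary deterministic policy that takes the action `f j` in the state `j`. -/
def stationary (f : ℕ → Bool) : Policy := fun _ j => PMF.pure (f j)

/-- The threshold policy `n`: passive in the states `j < n`, active in the states `j ≥ n`. -/
def threshold (n : ℕ) : Policy := stationary fun j => decide (n ≤ j)

/-- The joint law of the past (states and actions before time `t`) and of the state at time `t`,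
under the policy `φ`, with initial state `i`. -/
def historyLaw (ρ : unitInterval) (φ : Policy) (i : ℕ) : ℕ → PMF (List (ℕ × Bool) × ℕ)
  | 0 => PMF.pure ([], i)
  | t + 1 => (historyLaw ρ φ i t).bind fun h =>
      (φ h.1 h.2).bind fun a => (step ρ h.2 a).map fun j => ((h.2, a) :: h.1, j)

/-- The joint law of the state and the action at time `t`. -/
def stateActionLaw (ρ : unitInterval) (φ : Policy) (i t : ℕ) : PMF (ℕ × Bool) :=
  (historyLaw ρ φ i t).bind fun h => (φ h.1 h.2).map fun a => (h.2, a)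

/-- The long-run average `limsup (1 / T) E[∑ t < T, C (s t, a t)]` of a cost `C` of states and
actions under the policy `φ`, with initial state `i`. -/
def average (ρ : unitInterval) (C : ℕ × Bool → ℝ) (φ : Policy) (i : ℕ) : EReal :=
  limsup (fun T : ℕ =>
    (((1 / (T : ℝ)) * ∑ t ∈ Finset.range T, expect (stateActionLaw ρ φ i t) C : ℝ) : EReal)) atTop

/-- The average penalty. -/
def averagePenalty (b : ℕ → ℝ) (ρ : unitInterval) (φ : Policy) (i : ℕ) : EReal :=
  average ρ (fun x => b x.1) φ i

/-- The average active time. -/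
def averageActive (ρ : unitInterval) (φ : Policy) (i : ℕ) : EReal :=
  average ρ (fun x => if x.2 then 1 else 0) φ i

/-- The average cost, where each scheduling of the user costs `W`. -/
def averageCost (b : ℕ → ℝ) (ρ : unitInterval) (W : ℝ) (φ : Policy) (i : ℕ) : EReal :=
  average ρ (fun x => b x.1 + W * (if x.2 then 1 else 0)) φ i

/-- The optimal average cost over all causal policies, for the initial state `i`. -/
def optimalValue (b : ℕ → ℝ) (ρ : unitInterval) (W : ℝ) (i : ℕ) : EReal :=
  ⨅ φ : Policy, averageCost b ρ W φ i

/-! ### Optimality of the passive action -/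

/-- The policy `φ` is average-cost optimal, among all causal policies and for each initial
state. -/
def IsOptimal (b : ℕ → ℝ) (ρ : unitInterval) (W : ℝ) (φ : Policy) : Prop :=
  ∀ i, averageCost b ρ W φ i = optimalValue b ρ W i

/-- The set of states in which some optimal stationary policy is passive. -/
def passiveSet (b : ℕ → ℝ) (ρ : unitInterval) (W : ℝ) : Set ℕ :=
  {j | ∃ f : ℕ → Bool, IsOptimal b ρ W (stationary f) ∧ f j = false}

/-- `θ` is the optimal value and `V` is a differential cost-to-go function (bounded below) that
solves the Bellman equation. -/
def IsBellmanSolution (b : ℕ → ℝ) (ρ : unitInterval) (W θ : ℝ) (V : ℕ → ℝ) : Prop :=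
  (∀ i, optimalValue b ρ W i = (θ : EReal)) ∧ BddBelow (Set.range V) ∧
    ∀ j, θ + V j =
      min (b j + V (j + 1)) (b j + W + (ρ : ℝ) * V 0 + (1 - (ρ : ℝ)) * V (j + 1))

/-- The set of states in which the passive action attains the minimum in the Bellman equation. -/
def bellmanPassiveSet (b : ℕ → ℝ) (ρ : unitInterval) (W : ℝ) : Set ℕ :=
  {j | ∃ (θ : ℝ) (V : ℕ → ℝ), IsBellmanSolution b ρ W θ V ∧
    b j + V (j + 1) ≤ b j + W + (ρ : ℝ) * V 0 + (1 - (ρ : ℝ)) * V (j + 1)}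

/-- Indexability: the set `D W` of the states in which passivity is optimal increases with `W`. -/
def Indexable (D : ℝ → Set ℕ) : Prop := ∀ W' W : ℝ, W' < W → D W' ⊆ D W

/-- The problem is indexable, and the Whittle index of the state `n` is `w n`: the least `W` for
which passivity is optimal in the state `n`. -/
def IsWhittleIndex (D : ℝ → Set ℕ) (w : ℕ → ℝ) : Prop :=
  Indexable D ∧ ∀ n, IsLeast {W : ℝ | n ∈ D W} (w n)

/-- As functions of `W`, the average costs of the threshold policies `n` and `n + 1` meet in
exactly one point, namely `w n`, for each `n` and each initial state. -/
def IsThresholdIntersection (b : ℕ → ℝ) (ρ : unitInterval) (w : ℕ → ℝ) : Prop :=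
  ∀ (n i : ℕ) (W : ℝ),
    averagePenalty b ρ (threshold n) i + (W : EReal) * averageActive ρ (threshold n) i =
      averagePenalty b ρ (threshold (n + 1)) i +
        (W : EReal) * averageActive ρ (threshold (n + 1)) i ↔
    W = w n

end WhittleAge

end

namespace WhittleAge

/-! ### Expectations under laws with finite support -/

section Expect

variable {α β : Type}

/-! Both penalties are instances of `IsActiveCost`: `b` is increasing and unbounded, and the penalty
`β` accumulated until delivery while staying active is increasing and comparable to `b`. Under the
threshold policy `n` a cycle from state 0 has `n` passive slots and then a geometric number, of mean
`1 / ρ`, of active ones. Hence the average cost is the cycle cost over the cycle length `n + 1 / ρ`,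
which is `gain`; `average_threshold` proves this from the Poisson equation and a geometric drift.

Raising the threshold by one adds `ρ * β (n + 1)` to the cycle cost and 1 to the cycle length. So
the gains of `n` and `n + 1` agree exactly when both equal `ρ * β (n + 1)`, that is, when `W` is
`indexFormula n`, which is strictly increasing in `n`. Consequently the first `N` with `W <
indexFormula N` is an optimal threshold: its `potential` solves the Bellman equation
(`bellman_equation`), and verification bounds every causal policy from below
(`le_average_of_subsolution`).

It remains to exclude passivity at `n` when `W < indexFormula n`. For the Bellman equation, every
solution bounded below is compared with the cost of staying active (`active_le_of_bellman`). For
stationary policies with `ρ < 1`, the potential is perturbed to show that passivity at `n` costs a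
positive amount on average (`exists_lt_averageCost`). Both passive sets are therefore `{n |
indexFormula n ≤ W}`, which gives indexability and the index at once. -/

lemma expect_eq_sum {q : PMF α} {S : Finset α} (hS : q.support ⊆ S) (f : α → ℝ) :
    expect q f = ∑ x ∈ S, (q x).toReal * f x := by
  unfold expect
  refine tsum_eq_sum fun x hx => ?_
  have : q x = 0 := by
    by_contra h
    exact hx (hS ((PMF.mem_support_iff q x).2 h))
  simp [this]

lemma expect_eq_sum_support {q : PMF α} (hq : q.support.Finite) (f : α → ℝ) :
    expect q f = ∑ x ∈ hq.toFinset, (q x).toReal * f x :=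
  expect_eq_sum (by simp) f

lemma finite_support_bind {q : PMF α} {k : α → PMF β} (hq : q.support.Finite)
    (hk : ∀ x, (k x).support.Finite) : (q.bind k).support.Finite := by
  rw [PMF.support_bind]
  exact hq.biUnion fun x _ => hk x

lemma finite_support_map {q : PMF α} (g : α → β) (hq : q.support.Finite) :
    (q.map g).support.Finite := by
  rw [PMF.support_map]
  exact hq.image g

lemma expect_bind {q : PMF α} {k : α → PMF β} (hq : q.support.Finite)
    (hk : ∀ x, (k x).support.Finite) (f : β → ℝ) :
    expect (q.bind k) f = expect q fun x => expect (k x) f := by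
  classical
  have hb := finite_support_bind hq hk
  set T : Finset β := hq.toFinset.biUnion fun x => (hk x).toFinset with hT
  have hbT : (q.bind k).support ⊆ T := by
    intro y hy
    rw [PMF.support_bind] at hy
    simpa [hT] using hy
  have hkT : ∀ x ∈ hq.toFinset, (k x).support ⊆ T := by
    intro x hx y hy
    rw [hT, Finset.coe_biUnion]
    exact Set.mem_biUnion hx (by simpa using hy)
  rw [expect_eq_sum hbT, expect_eq_sum_support hq]
  have h1 : ∀ y, ((q.bind k) y).toReal =
      ∑ x ∈ hq.toFinset, (q x).toReal * (k x y).toReal := by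
    intro y
    rw [PMF.bind_apply, tsum_eq_sum (s := hq.toFinset), ENNReal.toReal_sum]
    · simp [ENNReal.toReal_mul]
    · intro x _
      exact ENNReal.mul_ne_top (PMF.apply_ne_top _ _) (PMF.apply_ne_top _ _)
    · intro x hx
      have : q x = 0 := by
        by_contra h
        exact hx (by simpa using h)
      simp [this]
  calc ∑ y ∈ T, ((q.bind k) y).toReal * f y
      = ∑ y ∈ T, ∑ x ∈ hq.toFinset, (q x).toReal * ((k x y).toReal * f y) := by
        refine Finset.sum_congr rfl fun y _ => ?_
        rw [h1, Finset.sum_mul]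
        exact Finset.sum_congr rfl fun x _ => by ring
    _ = ∑ x ∈ hq.toFinset, ∑ y ∈ T, (q x).toReal * ((k x y).toReal * f y) :=
        Finset.sum_comm
    _ = _ := by
        refine Finset.sum_congr rfl fun x hx => ?_
        rw [expect_eq_sum (hkT x hx), Finset.mul_sum]

lemma finite_support_pure (x : α) : (PMF.pure x).support.Finite := by
  rw [PMF.support_pure]
  exact Set.finite_singleton x

lemma expect_pure (x : α) (f : α → ℝ) : expect (PMF.pure x) f = f x := by
  classical
  rw [expect_eq_sum (S := {x}) (by simp)]
  simp

lemma expect_map {q : PMF α} (hq : q.support.Finite) (g : α → β) (f : β → ℝ) :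
    expect (q.map g) f = expect q fun x => f (g x) := by
  have : q.map g = q.bind fun x => PMF.pure (g x) := rfl
  rw [this, expect_bind hq fun x => finite_support_pure _]
  simp only [expect_pure]

lemma expect_add {q : PMF α} (hq : q.support.Finite) (f g : α → ℝ) :
    expect q (fun x => f x + g x) = expect q f + expect q g := by
  simp only [expect_eq_sum_support hq, mul_add, Finset.sum_add_distrib]

lemma expect_const_mul {q : PMF α} (hq : q.support.Finite) (c : ℝ) (f : α → ℝ) :
    expect q (fun x => c * f x) = c * expect q f := by
  simp only [expect_eq_sum_support hq, Finset.mul_sum]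
  exact Finset.sum_congr rfl fun x _ => by ring

lemma expect_const {q : PMF α} (hq : q.support.Finite) (c : ℝ) :
    expect q (fun _ => c) = c := by
  rw [expect_eq_sum_support hq, ← Finset.sum_mul, ← ENNReal.toReal_sum]
  · have h : ∑ x ∈ hq.toFinset, q x = 1 := by
      rw [← q.tsum_coe, tsum_eq_sum]
      intro x hx
      by_contra h
      exact hx (by simpa using h)
    simp [h]
  · intro x _
    exact PMF.apply_ne_top _ _

lemma expect_mono {q : PMF α} (hq : q.support.Finite) {f g : α → ℝ}
    (h : ∀ x, q x ≠ 0 → f x ≤ g x) : expect q f ≤ expect q g := by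
  simp only [expect_eq_sum_support hq]
  refine Finset.sum_le_sum fun x hx => ?_
  exact mul_le_mul_of_nonneg_left (h x (by simpa using hx)) ENNReal.toReal_nonneg

end Expect

lemma expect_coin (r : unitInterval) (f : Bool → ℝ) :
    expect (coin r) f = r * f true + (1 - r) * f false := by
  have h0 := r.2.1
  rw [expect_eq_sum (S := Finset.univ) (fun _ _ => Finset.mem_coe.2 (Finset.mem_univ _))]
  simp [coin, ENNReal.toReal_ofReal, h0, r.2.2]

/-! ### The dynamics -/

lemma finite_support_bool (q : PMF Bool) : q.support.Finite := Set.toFinite _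

lemma finite_support_step (ρ : unitInterval) (j : ℕ) (a : Bool) :
    (step ρ j a).support.Finite := finite_support_map _ (finite_support_bool _)

lemma expect_step_true (ρ : unitInterval) (j : ℕ) (f : ℕ → ℝ) :
    expect (step ρ j true) f = ρ * f 0 + (1 - ρ) * f (j + 1) := by
  rw [step, expect_map (finite_support_bool _), expect_coin]
  simp

lemma expect_step_false (ρ : unitInterval) (j : ℕ) (f : ℕ → ℝ) :
    expect (step ρ j false) f = f (j + 1) := by
  rw [step, expect_map (finite_support_bool _), expect_coin]
  simp only [Bool.false_and, Bool.false_eq_true, if_false]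
  ring

lemma finite_support_historyLaw (ρ : unitInterval) (φ : Policy) (i t : ℕ) :
    (historyLaw ρ φ i t).support.Finite := by
  induction t with
  | zero => exact finite_support_pure _
  | succ t ih =>
    exact finite_support_bind ih fun h => finite_support_bind (finite_support_bool _) fun a =>
      finite_support_map _ (finite_support_step _ _ _)

/-- The expectation of a function of the state at time `t`. -/
noncomputable def stateMean (ρ : unitInterval) (φ : Policy) (i t : ℕ) (f : ℕ → ℝ) : ℝ :=
  expect (historyLaw ρ φ i t) fun h => f h.2

lemma stateMean_zero (ρ : unitInterval) (φ : Policy) (i : ℕ) (f : ℕ → ℝ) :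
    stateMean ρ φ i 0 f = f i := by
  simp [stateMean, historyLaw, expect_pure]

lemma stateMean_succ (ρ : unitInterval) (φ : Policy) (i t : ℕ) (f : ℕ → ℝ) :
    stateMean ρ φ i (t + 1) f = expect (historyLaw ρ φ i t) fun h =>
      expect (φ h.1 h.2) fun a => expect (step ρ h.2 a) f := by
  rw [stateMean, historyLaw, expect_bind (finite_support_historyLaw _ _ _ _)]
  · refine congrArg _ (funext fun h => ?_)
    rw [expect_bind (finite_support_bool _)]
    · refine congrArg _ (funext fun a => ?_)
      rw [expect_map (finite_support_step _ _ _)]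
    · exact fun a => finite_support_map _ (finite_support_step _ _ _)
  · exact fun h => finite_support_bind (finite_support_bool _) fun a =>
      finite_support_map _ (finite_support_step _ _ _)

lemma expect_stateActionLaw (ρ : unitInterval) (φ : Policy) (i t : ℕ) (C : ℕ × Bool → ℝ) :
    expect (stateActionLaw ρ φ i t) C = expect (historyLaw ρ φ i t) fun h =>
      expect (φ h.1 h.2) fun a => C (h.2, a) := by
  rw [stateActionLaw, expect_bind (finite_support_historyLaw _ _ _ _)]
  · refine congrArg _ (funext fun h => ?_)
    rw [expect_map (finite_support_bool _)]
  · exact fun h => finite_support_map _ (finite_support_bool _)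

/-- One step of the verification argument: a subsolution of the optimality equation for the
actions that the policy uses. -/
lemma subsolution_step {ρ : unitInterval} {φ : Policy} {C : ℕ × Bool → ℝ} {θ : ℝ} {V : ℕ → ℝ}
    (h : ∀ l j a, φ l j a ≠ 0 → θ + V j ≤ C (j, a) + expect (step ρ j a) V) (i t : ℕ) :
    θ + stateMean ρ φ i t V ≤
      expect (stateActionLaw ρ φ i t) C + stateMean ρ φ i (t + 1) V := by
  have hH := finite_support_historyLaw ρ φ i t
  rw [stateMean_succ, expect_stateActionLaw, ← expect_add hH, stateMean,
    ← expect_const hH θ, ← expect_add hH]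
  refine expect_mono hH fun x _ => ?_
  rw [← expect_add (finite_support_bool _), ← expect_const (finite_support_bool (φ x.1 x.2))
    (θ + V x.2)]
  exact expect_mono (finite_support_bool _) fun a ha => h x.1 x.2 a ha

/-- Telescoping of `subsolution_step`. The terminal mean of `V` is kept, since for a general policy
it need not be negligible. -/
lemma subsolution_sum {ρ : unitInterval} {φ : Policy} {C : ℕ × Bool → ℝ} {θ : ℝ} {V : ℕ → ℝ}
    (h : ∀ l j a, φ l j a ≠ 0 → θ + V j ≤ C (j, a) + expect (step ρ j a) V) (i T : ℕ) :
    T * θ + V i ≤ ∑ t ∈ Finset.range T, expect (stateActionLaw ρ φ i t) C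
      + stateMean ρ φ i T V := by
  induction T with
  | zero => simp [stateMean_zero]
  | succ T ih =>
    have := subsolution_step h i T
    rw [Finset.sum_range_succ]
    push_cast
    linarith

lemma stateMean_le_mul_add {ρ : unitInterval} {φ : Policy} {f g : ℕ → ℝ} {c k : ℝ}
    (h : ∀ j, f j ≤ c * g j + k) (i t : ℕ) :
    stateMean ρ φ i t f ≤ c * stateMean ρ φ i t g + k := by
  have hH := finite_support_historyLaw ρ φ i t
  rw [stateMean, stateMean, ← expect_const_mul hH]
  conv_rhs => rw [← expect_const hH k]
  rw [← expect_add hH]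
  exact expect_mono hH fun x _ => h x.2

lemma stateMean_neg (ρ : unitInterval) (φ : Policy) (i t : ℕ) (f : ℕ → ℝ) :
    stateMean ρ φ i t (fun j => -f j) = -stateMean ρ φ i t f := by
  have := expect_const_mul (finite_support_historyLaw ρ φ i t) (-1) fun x => f x.2
  simpa only [neg_one_mul, stateMean] using this

/-- If the cost dominates the potential up to constants, then a subsolution bounds the average
cost from below. -/
lemma le_average_of_subsolution {ρ : unitInterval} {φ : Policy} {C : ℕ × Bool → ℝ} {θ c k : ℝ}
    {V : ℕ → ℝ} (h : ∀ l j a, φ l j a ≠ 0 → θ + V j ≤ C (j, a) + expect (step ρ j a) V)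
    (hc : 0 < c) (hV : ∀ j a, V j ≤ c * C (j, a) + k) (i : ℕ) :
    (θ : EReal) ≤ average ρ C φ i := by
  by_contra hlt
  rw [not_le] at hlt
  obtain ⟨x, hx1, hx2⟩ := EReal.lt_iff_exists_real_btwn.1 hlt
  have hxθ : x < θ := EReal.coe_lt_coe_iff.1 hx2
  set e : ℕ → ℝ := fun t => expect (stateActionLaw ρ φ i t) C with he
  have hev : ∀ᶠ T : ℕ in atTop, ∑ t ∈ Finset.range T, e t < x * T := by
    have h1 := eventually_lt_of_limsup_lt hx1
    filter_upwards [h1, eventually_gt_atTop 0] with T hT hpos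
    have hT' : (0 : ℝ) < T := by exact_mod_cast hpos
    have h2 := EReal.coe_lt_coe_iff.1 hT
    rw [one_div, inv_mul_lt_iff₀ hT'] at h2
    linarith
  have hVe : ∀ t, stateMean ρ φ i t V ≤ c * e t + k := by
    intro t
    have hH := finite_support_historyLaw ρ φ i t
    rw [he]
    simp only
    rw [expect_stateActionLaw, stateMean, ← expect_const_mul hH]
    conv_rhs => rw [← expect_const hH k]
    rw [← expect_add hH]
    refine expect_mono hH fun y _ => ?_
    have hB := finite_support_bool (φ y.1 y.2)
    rw [← expect_const_mul hB]
    conv_rhs => rw [← expect_const hB k]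
    rw [← expect_add hB]
    conv_lhs => rw [← expect_const hB (V y.2)]
    exact expect_mono hB fun a _ => hV _ _
  -- This replaces a transversality condition: if the partial sums stay below `x * T`, the terminal
  -- mean of `V` grows linearly, hence so does the cost of the single slot `T`, and the sums then
  -- outgrow `x * T`.
  have hgrow : ∀ᶠ T : ℕ in atTop, x + 1 ≤ e T := by
    have hlin : Tendsto (fun T : ℕ => (T : ℝ) * (θ - x)) atTop atTop :=
      tendsto_natCast_atTop_atTop.atTop_mul_const (by linarith)
    filter_upwards [hev, hlin.eventually_ge_atTop (c * (x + 1) + k - V i)] with T h1 h2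
    have h3 := subsolution_sum h i T
    have h4 := hVe T
    have h5 : c * (x + 1) ≤ c * e T := by
      have : ∑ t ∈ Finset.range T, e t = ∑ t ∈ Finset.range T,
        expect (stateActionLaw ρ φ i t) C := rfl
      nlinarith
    exact le_of_mul_le_mul_left h5 hc
  obtain ⟨N, hN⟩ := eventually_atTop.1 (hev.and hgrow)
  have hsum : ∀ m : ℕ, ∑ t ∈ Finset.range N, e t + m * (x + 1) ≤
      ∑ t ∈ Finset.range (N + m), e t := by
    intro m
    induction m with
    | zero => simp
    | succ m ih =>
      have := (hN (N + m) (by omega)).2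
      rw [← add_assoc, Finset.sum_range_succ]
      push_cast
      linarith
  obtain ⟨m, hm⟩ := exists_nat_gt (x * N - ∑ t ∈ Finset.range N, e t)
  have h1 := hsum m
  have h2 := (hN (N + m) (by omega)).1
  push_cast at h2
  linarith

/-- A solution of the Poisson equation whose mean stays bounded gives the average cost. -/
lemma average_eq_of_poisson {ρ : unitInterval} {φ : Policy} {C : ℕ × Bool → ℝ} {g M : ℝ}
    {h : ℕ → ℝ} (hp : ∀ l j a, φ l j a ≠ 0 → g + h j = C (j, a) + expect (step ρ j a) h) (i : ℕ)
    (hM : ∀ t, |stateMean ρ φ i t h| ≤ M) : average ρ C φ i = g := by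
  have hneg : ∀ l j a, φ l j a ≠ 0 →
      -g + -h j ≤ -C (j, a) + expect (step ρ j a) fun j => -h j := by
    intro l j a ha
    have h1 := hp l j a ha
    have h2 := expect_const_mul (finite_support_step ρ j a) (-1) h
    simp only [neg_one_mul] at h2
    linarith
  have hsum : ∀ T : ℕ, |∑ t ∈ Finset.range T, expect (stateActionLaw ρ φ i t) C - T * g| ≤
      |h i| + M := by
    intro T
    have h1 := subsolution_sum (fun l j a ha => (hp l j a ha).le) i T
    -- Equality in the Poisson equation makes `-h` a subsolution for `-C`, which supplies the
    -- opposite bound.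
    have h2 := subsolution_sum (C := fun x => -C x) hneg i T
    have h3 : ∀ t, expect (stateActionLaw ρ φ i t) (fun x => -C x)
        = -expect (stateActionLaw ρ φ i t) C := by
      intro t
      have := expect_const_mul (q := stateActionLaw ρ φ i t) (finite_support_bind
        (finite_support_historyLaw ρ φ i t)
        fun h => finite_support_map _ (finite_support_bool _)) (-1) C
      simpa only [neg_one_mul] using this
    simp only [h3, stateMean_neg, Finset.sum_neg_distrib] at h2
    have h5 := abs_le.1 (hM T)
    have h6 := neg_abs_le (h i)
    have h7 := le_abs_self (h i)
    rw [abs_le]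
    constructor <;> linarith
  have hlim : Tendsto (fun T : ℕ => (1 / (T : ℝ)) *
      ∑ t ∈ Finset.range T, expect (stateActionLaw ρ φ i t) C) atTop (nhds g) := by
    rw [tendsto_iff_norm_sub_tendsto_zero]
    have h0 : Tendsto (fun T : ℕ => (|h i| + M) / (T : ℝ)) atTop (nhds 0) :=
      tendsto_const_div_atTop_nhds_zero_nat _
    refine squeeze_zero' (Eventually.of_forall fun _ => norm_nonneg _) ?_ h0
    filter_upwards [eventually_gt_atTop 0] with T hT
    have hT' : (0 : ℝ) < T := by exact_mod_cast hT
    rw [Real.norm_eq_abs, le_div_iff₀ hT']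
    calc _ = |(1 / (T : ℝ) * ∑ t ∈ Finset.range T, expect (stateActionLaw ρ φ i t) C - g) * T| := by
          rw [abs_mul, abs_of_pos hT']
      _ = |∑ t ∈ Finset.range T, expect (stateActionLaw ρ φ i t) C - T * g| := by
          congr 1
          field_simp
      _ ≤ _ := hsum T
  exact ((continuous_coe_real_ereal.tendsto g).comp hlim).limsup_eq

/-- A Lyapunov function with geometric drift has a bounded mean. -/
lemma stateMean_le_of_drift {ρ : unitInterval} {φ : Policy} {L : ℕ → ℝ} {r K : ℝ}
    (hr0 : 0 ≤ r) (hr : r < 1)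
    (h : ∀ l j a, φ l j a ≠ 0 → expect (step ρ j a) L ≤ r * L j + K) (i : ℕ) :
    ∃ M, ∀ t, stateMean ρ φ i t L ≤ M := by
  refine ⟨max (L i) (K / (1 - r)), fun t => ?_⟩
  induction t with
  | zero => simp [stateMean_zero]
  | succ t ih =>
    have hH := finite_support_historyLaw ρ φ i t
    have h1 : stateMean ρ φ i (t + 1) L ≤ r * stateMean ρ φ i t L + K := by
      rw [stateMean_succ, stateMean, ← expect_const_mul hH]
      conv_rhs => rw [← expect_const hH K]
      rw [← expect_add hH]
      refine expect_mono hH fun y _ => ?_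
      have hB := finite_support_bool (φ y.1 y.2)
      conv_rhs => rw [← expect_const hB (r * L y.2 + K)]
      exact expect_mono hB fun a ha => h _ _ _ ha
    have h2 := le_max_right (L i) (K / (1 - r))
    rw [div_le_iff₀ (by linarith)] at h2
    nlinarith [mul_le_mul_of_nonneg_left ih hr0]

/-! ### Threshold policies -/

/-- The penalty `b` is strictly increasing and unbounded, and `β j` is the expected penalty until
the next delivery when the user stays active from the state `j` on, which grows like `b`. -/
structure IsActiveCost (ρ : unitInterval) (b β : ℕ → ℝ) : Prop where
  pos : 0 < (ρ : ℝ)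
  nonneg : ∀ j, 0 ≤ b j
  strictMono : StrictMono b
  tendsto : Tendsto b atTop atTop
  eq_add : ∀ j, β j = b j + (1 - ρ) * β (j + 1)
  strictMono_active : StrictMono β
  le_mul_add : ∃ c k, 1 ≤ c ∧ 0 ≤ k ∧ ∀ j, β j ≤ c * b j + k

/-- The expected penalty in a cycle between two deliveries under the threshold policy `n`. -/
noncomputable def cycleCost (b β : ℕ → ℝ) (n : ℕ) : ℝ := ∑ k ∈ Finset.range n, b k + β n

/-- The average cost of the threshold policy `n`, for the cost `α * b` of a slot and the
cost `W` of an active slot. -/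
noncomputable def gain (ρ : unitInterval) (b β : ℕ → ℝ) (α W : ℝ) (n : ℕ) : ℝ :=
  (α * cycleCost b β n + W / ρ) / (n + 1 / ρ)

/-- The differential cost of the threshold policy `n`. -/
noncomputable def potential (ρ : unitInterval) (b β : ℕ → ℝ) (α W : ℝ) (n j : ℕ) : ℝ :=
  ∑ k ∈ Finset.Ico j n, (α * b k - gain ρ b β α W n) + α * β (max j n)
    + (W - gain ρ b β α W n) / ρ

/-- The cost at which the threshold policies `n` and `n + 1` are equally good. -/
noncomputable def indexFormula (ρ : unitInterval) (b β : ℕ → ℝ) (n : ℕ) : ℝ :=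
  ρ * ((ρ * n + 1) * β (n + 1) - cycleCost b β n)

section Potential

variable {ρ : unitInterval} {b β : ℕ → ℝ} {α W : ℝ} {n : ℕ}

lemma potential_of_le {j : ℕ} (h : n ≤ j) :
    potential ρ b β α W n j = α * β j + (W - gain ρ b β α W n) / ρ := by
  simp [potential, Finset.Ico_eq_empty_of_le h, max_eq_left h]

lemma potential_of_lt {j : ℕ} (h : j < n) : potential ρ b β α W n j =
    α * b j - gain ρ b β α W n + potential ρ b β α W n (j + 1) := by
  rw [potential, potential, Finset.sum_eq_sum_Ico_succ_bot h, max_eq_right h.le,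
    max_eq_right (Nat.succ_le_of_lt h)]
  ring

/-- This normalization is the defining relation of `gain`: cycle cost minus gain times cycle length
vanishes. -/
lemma potential_zero (hρ : 0 < (ρ : ℝ)) : potential ρ b β α W n 0 = 0 := by
  have h : (0 : ℝ) < n + 1 / ρ := by positivity
  have hg : gain ρ b β α W n * (n + 1 / ρ) = α * cycleCost b β n + W / ρ := by
    rw [gain, div_mul_cancel₀ _ h.ne']
  rw [cycleCost] at hg
  rw [potential, max_eq_right (Nat.zero_le n), ← Finset.range_eq_Ico, Finset.sum_sub_distrib,
    ← Finset.mul_sum, Finset.sum_const, Finset.card_range, nsmul_eq_mul, sub_div]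
  linear_combination -hg

end Potential

lemma stationary_apply_ne_zero {f : ℕ → Bool} {l : List (ℕ × Bool)} {j : ℕ} {a : Bool}
    (h : stationary f l j a ≠ 0) : a = f j := by
  by_contra hne
  exact h (by simp [stationary, PMF.pure_apply, hne])

namespace IsActiveCost

variable {ρ : unitInterval} {b β : ℕ → ℝ} (H : IsActiveCost ρ b β)
include H

/-- Replace `β (j + 1)` by the smaller `β j` in the recursion `eq_add`. -/
lemma le_mul_active (j : ℕ) : b j ≤ ρ * β j := by
  have h1 := H.eq_add j
  have h2 := H.strictMono_active (Nat.lt_succ_self j)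
  have h3 := sub_nonneg.2 ρ.2.2
  have h4 := mul_le_mul_of_nonneg_left h2.le h3
  simp only [Nat.succ_eq_add_one] at h4
  linarith

lemma active_nonneg (j : ℕ) : 0 ≤ β j := by
  have h1 := (H.nonneg j).trans (H.le_mul_active j)
  exact nonneg_of_mul_nonneg_right h1 H.pos

/-- Makes `β + A` a Lyapunov function for the active action. By `eq_add`, `(1 - ρ) * β (j + 1)` is
`β j - b j`, and `b j` is at least `(β j - k) / c`, so `β` contracts up to the constant `k / c`. -/
lemma exists_drift : ∃ A r : ℝ, 1 ≤ A ∧ 0 ≤ r ∧ r < 1 ∧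
    ∀ j, (1 - ρ) * (β (j + 1) + A) ≤ r * (β j + A) := by
  obtain ⟨c, k, hc, hk, hle⟩ := H.le_mul_add
  have hρ := H.pos
  have hρ1 := ρ.2.2
  have hc0 : 0 < c := by linarith
  -- `A` is chosen so that `k / c ≤ ρ / 2 * A`: half of the contraction of `A` by `1 - ρ` absorbs
  -- the constant.
  refine ⟨1 + 2 * k / (c * ρ), max (1 - 1 / c) (1 - ρ / 2), ?_, ?_, ?_, fun j => ?_⟩
  · have : 0 ≤ 2 * k / (c * ρ) := by positivity
    linarith
  · exact le_max_of_le_right (by linarith)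
  · have : 0 < 1 / c := by positivity
    exact max_lt (by linarith) (by linarith)
  · have h1 := H.eq_add j
    have h2 : (β j - k) / c ≤ b j := by
      rw [div_le_iff₀ hc0]
      linarith [hle j]
    set A : ℝ := 1 + 2 * k / (c * ρ) with hA
    have h3 : k / c ≤ ρ / 2 * A := by
      have : ρ / 2 * A = ρ / 2 + k / c := by
        rw [hA]
        field_simp
      linarith
    have hA0 : 0 ≤ A := by positivity
    have h4 := mul_le_mul_of_nonneg_right (le_max_left (1 - 1 / c) (1 - (ρ : ℝ) / 2))
      (H.active_nonneg j)
    have h5 := mul_le_mul_of_nonneg_right (le_max_right (1 - 1 / c) (1 - (ρ : ℝ) / 2)) hA0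
    have h6 : (β j - k) / c = β j * (1 / c) - k / c := by ring
    nlinarith

lemma abs_potential_le (α W : ℝ) (n : ℕ) :
    ∃ k, 0 ≤ k ∧ ∀ j, |potential ρ b β α W n j| ≤ |α| * β j + k := by
  refine ⟨∑ i ∈ Finset.range n, |α * b i - gain ρ b β α W n| + |α| * β n
    + |(W - gain ρ b β α W n) / ρ|, ?_, fun j => ?_⟩
  · have := H.active_nonneg n
    positivity
  · have h1 : |∑ i ∈ Finset.Ico j n, (α * b i - gain ρ b β α W n)| ≤
        ∑ i ∈ Finset.range n, |α * b i - gain ρ b β α W n| :=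
      (Finset.abs_sum_le_sum_abs _ _).trans (Finset.sum_le_sum_of_subset_of_nonneg
        (fun i hi => Finset.mem_range.2 (Finset.mem_Ico.1 hi).2) fun _ _ _ => abs_nonneg _)
    have h2 : |α * β (max j n)| ≤ |α| * β j + |α| * β n := by
      rw [abs_mul, abs_of_nonneg (H.active_nonneg _), ← mul_add]
      refine mul_le_mul_of_nonneg_left ?_ (abs_nonneg _)
      have := H.active_nonneg j
      have := H.active_nonneg n
      rcases max_choice j n with h | h <;> rw [h] <;> linarith
    have h3 := abs_add_le (∑ i ∈ Finset.Ico j n, (α * b i - gain ρ b β α W n)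
      + α * β (max j n)) ((W - gain ρ b β α W n) / ρ)
    have h4 := abs_add_le (∑ i ∈ Finset.Ico j n, (α * b i - gain ρ b β α W n))
      (α * β (max j n))
    rw [potential]
    linarith

lemma poisson_threshold (α W : ℝ) (n : ℕ) (l : List (ℕ × Bool)) (j : ℕ) (a : Bool)
    (ha : threshold n l j a ≠ 0) : gain ρ b β α W n + potential ρ b β α W n j =
      α * b j + W * (if a then 1 else 0) + expect (step ρ j a) (potential ρ b β α W n) := by
  have hρ := H.pos
  obtain rfl : a = decide (n ≤ j) := stationary_apply_ne_zero ha
  by_cases hj : n ≤ j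
  · simp only [hj, decide_true, if_true]
    rw [expect_step_true, potential_zero hρ, potential_of_le hj,
      potential_of_le (Nat.le_succ_of_le hj), H.eq_add j]
    field_simp
    ring
  · simp only [hj, decide_false, Bool.false_eq_true, if_false]
    rw [expect_step_false, potential_of_lt (not_le.1 hj)]
    ring

/-- The weight `α` yields the cost, the penalty and the active time from one computation: `(α, W)`
is `(1, W)`, `(1, 0)` or `(0, 1)`. -/
lemma average_threshold (α W : ℝ) (n i : ℕ) :
    average ρ (fun x => α * b x.1 + W * (if x.2 then 1 else 0)) (threshold n) i =
      (gain ρ b β α W n : EReal) := by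
  obtain ⟨A, r, hA, hr0, hr1, hdrift⟩ := H.exists_drift
  have hρ := H.pos
  obtain ⟨M, hM⟩ := stateMean_le_of_drift (φ := threshold n) (ρ := ρ) (L := fun j => β j + A)
    (K := ρ * (β 0 + A) + (β n + A)) hr0 hr1 (by
      intro l j a ha
      obtain rfl : a = decide (n ≤ j) := stationary_apply_ne_zero ha
      have h0 := H.active_nonneg 0
      have hn := H.active_nonneg n
      have hj0 := H.active_nonneg j
      by_cases hj : n ≤ j
      · simp only [hj, decide_true]
        rw [expect_step_true]
        linarith [hdrift j]
      · simp only [hj, decide_false]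
        rw [expect_step_false]
        -- A passive step from below the threshold ends at most at `n`, so the constant `K` covers
        -- it.
        have h1 : β (j + 1) ≤ β n := H.strictMono_active.monotone (not_le.1 hj)
        have h2 : 0 ≤ r * (β j + A) := by positivity
        have h3 : 0 ≤ ρ * (β 0 + A) := by positivity
        linarith) i
  obtain ⟨k, hk, hle⟩ := H.abs_potential_le α W n
  refine average_eq_of_poisson (M := |α| * M + k)
    (fun l j a ha => H.poisson_threshold α W n l j a ha) i fun t => ?_
  have hα := abs_nonneg α
  have hαA : 0 ≤ |α| * A := by positivity
  have h1 := mul_le_mul_of_nonneg_left (hM t) hα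
  have h2 := stateMean_le_mul_add (ρ := ρ) (φ := threshold n) (f := potential ρ b β α W n)
    (g := fun j => β j + A) (c := |α|) (k := k)
    (fun j => by linarith [le_abs_self (potential ρ b β α W n j), hle j]) i t
  have h3 := stateMean_le_mul_add (ρ := ρ) (φ := threshold n)
    (f := fun j => -potential ρ b β α W n j)
    (g := fun j => β j + A) (c := |α|) (k := k)
    (fun j => by linarith [neg_le_abs (potential ρ b β α W n j), hle j]) i t
  rw [stateMean_neg] at h3
  rw [abs_le]
  constructor <;> linarith

lemma averageCost_threshold (W : ℝ) (n i : ℕ) :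
    averageCost b ρ W (threshold n) i = (gain ρ b β 1 W n : EReal) := by
  simpa [averageCost] using H.average_threshold 1 W n i

lemma averagePenalty_threshold (n i : ℕ) :
    averagePenalty b ρ (threshold n) i = (gain ρ b β 1 0 n : EReal) := by
  simpa [averagePenalty] using H.average_threshold 1 0 n i

lemma averageActive_threshold (n i : ℕ) :
    averageActive ρ (threshold n) i = (gain ρ b β 0 1 n : EReal) := by
  simpa [averageActive] using H.average_threshold 0 1 n i

/-! ### The index -/

lemma cycleCost_succ (n : ℕ) : cycleCost b β (n + 1) = cycleCost b β n + ρ * β (n + 1) := by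
  rw [cycleCost, cycleCost, Finset.sum_range_succ, H.eq_add n]
  ring

lemma indexFormula_lt_succ (n : ℕ) : indexFormula ρ b β n < indexFormula ρ b β (n + 1) := by
  have hρ := H.pos
  have h1 : indexFormula ρ b β (n + 1) - indexFormula ρ b β n =
      ρ * (ρ * (n + 1) + 1) * (β (n + 1 + 1) - β (n + 1)) := by
    rw [indexFormula, indexFormula, H.cycleCost_succ]
    push_cast
    ring
  have h2 : 0 < β (n + 1 + 1) - β (n + 1) := sub_pos.2 (H.strictMono_active (Nat.lt_succ_self _))
  have h3 : 0 < ρ * (ρ * ((n : ℝ) + 1) + 1) * (β (n + 1 + 1) - β (n + 1)) := by positivity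
  linarith

lemma strictMono_indexFormula : StrictMono (indexFormula ρ b β) :=
  strictMono_nat_of_lt_succ H.indexFormula_lt_succ

/-- The difference `gain n - ρ * β (n + 1)` is a positive multiple of `W - indexFormula n`. -/
lemma indexFormula_le_iff {W : ℝ} {n : ℕ} :
    indexFormula ρ b β n ≤ W ↔ ρ * β (n + 1) ≤ gain ρ b β 1 W n := by
  have hρ := H.pos
  rw [gain, le_div_iff₀ (by positivity), indexFormula, ← sub_nonneg,
    ← sub_nonneg (b := _ * _ * _)]
  have : 1 * cycleCost b β n + W / ρ - ρ * β (n + 1) * (n + 1 / ρ) =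
      (W - ρ * ((ρ * n + 1) * β (n + 1) - cycleCost b β n)) / ρ := by
    field_simp
    ring
  rw [this, le_div_iff₀ hρ, zero_mul]

/-- The gain of `n + 1` is the mediant of the gain of `n` and `ρ * β (n + 1)`, so comparing either
gain with that number is the same. -/
lemma indexFormula_le_iff_succ {W : ℝ} {n : ℕ} :
    indexFormula ρ b β n ≤ W ↔ ρ * β (n + 1) ≤ gain ρ b β 1 W (n + 1) := by
  have hρ := H.pos
  rw [gain, le_div_iff₀ (by positivity), indexFormula, ← sub_nonneg,
    ← sub_nonneg (b := _ * _ * _), H.cycleCost_succ]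
  have : 1 * (cycleCost b β n + ρ * β (n + 1)) + W / ρ
        - ρ * β (n + 1) * (((n + 1 : ℕ) : ℝ) + 1 / ρ) =
      (W - ρ * ((ρ * n + 1) * β (n + 1) - cycleCost b β n)) / ρ := by
    push_cast
    field_simp
    ring
  rw [this, le_div_iff₀ hρ, zero_mul]

lemma isThresholdIntersection :
    IsThresholdIntersection b ρ (indexFormula ρ b β) := by
  intro n i W
  have hρ := H.pos
  rw [H.averagePenalty_threshold, H.averagePenalty_threshold, H.averageActive_threshold,
    H.averageActive_threshold]
  norm_cast
  have h1 : (0 : ℝ) < n + 1 / ρ := by positivity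
  have h2 : (0 : ℝ) < n + 1 + 1 / ρ := by positivity
  have h3 : ∀ m : ℕ, gain ρ b β 1 0 m + W * gain ρ b β 0 1 m =
      (cycleCost b β m + W / ρ) / (m + 1 / ρ) := by
    intro m
    rw [gain, gain]
    ring
  rw [h3, h3]
  push_cast
  rw [div_eq_div_iff h1.ne' h2.ne', H.cycleCost_succ, indexFormula, ← sub_eq_zero,
    ← sub_eq_zero (a := W)]
  have : (cycleCost b β n + W / ρ) * (n + 1 + 1 / ρ)
        - (cycleCost b β n + ρ * β (n + 1) + W / ρ) * (n + 1 / ρ) =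
      (W - ρ * ((ρ * n + 1) * β (n + 1) - cycleCost b β n)) / ρ := by
    field_simp
    ring
  rw [this, div_eq_zero_iff]
  simp [hρ.ne']

end IsActiveCost

variable {ρ : unitInterval} {b β : ℕ → ℝ}

/-! ### Optimality of threshold policies -/

lemma le_averageCost_of_subsolution {φ : Policy} {W θ c k : ℝ} {V : ℕ → ℝ}
    (h : ∀ l j a, φ l j a ≠ 0 →
      θ + V j ≤ b j + W * (if a then 1 else 0) + expect (step ρ j a) V)
    (hc : 0 < c) (hV : ∀ j, V j ≤ c * b j + k) (i : ℕ) :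
    (θ : EReal) ≤ averageCost b ρ W φ i := by
  refine le_average_of_subsolution (c := c) (k := k + c * |W|) h hc (fun j a => ?_) i
  have h1 : -|W| ≤ W * (if a then 1 else 0) := by
    cases a
    · simp
    · simpa using neg_abs_le W
  have h2 := mul_le_mul_of_nonneg_left h1 hc.le
  have h3 := hV j
  simp only
  linarith

/-- `n` is an optimal threshold for the charge `W`. -/
lemma exists_threshold (hw : Tendsto (indexFormula ρ b β) atTop atTop) (W : ℝ) :
    ∃ n, W < indexFormula ρ b β n ∧ ∀ m, m < n → indexFormula ρ b β m ≤ W := by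
  classical
  have hex : ∃ n, W < indexFormula ρ b β n := (hw.eventually_gt_atTop W).exists
  exact ⟨Nat.find hex, Nat.find_spec hex, fun m hm => not_lt.1 (Nat.find_min hex hm)⟩

namespace IsActiveCost

variable (H : IsActiveCost ρ b β)
include H

lemma exists_potential_le (W : ℝ) (n : ℕ) :
    ∃ c k, 0 < c ∧ ∀ j, potential ρ b β 1 W n j ≤ c * b j + k := by
  obtain ⟨c, k, hc, _, hle⟩ := H.le_mul_add
  obtain ⟨k', _, hle'⟩ := H.abs_potential_le 1 W n
  refine ⟨c, k + k', by linarith, fun j => ?_⟩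
  have h1 := hle j
  have h2 := hle' j
  have h3 := le_abs_self (potential ρ b β 1 W n j)
  rw [abs_one, one_mul] at h2
  linarith

section Threshold

variable {W : ℝ} {n : ℕ}

/-- Since the potential vanishes at 0, this says that passivity attains the Bellman minimum at `j`.
Just below the threshold it is `indexFormula_le_iff_succ`. Further down, `b (j + 1) ≤ ρ * β n ≤
gain` makes the potential nondecreasing up to `n`. -/
lemma potential_succ_le (hn : ∀ m, m < n → indexFormula ρ b β m ≤ W) {j : ℕ} (hj : j < n) :
    ρ * potential ρ b β 1 W n (j + 1) ≤ W := by
  have hρ := H.pos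
  obtain ⟨m, rfl⟩ : ∃ m, n = m + 1 := ⟨n - 1, by omega⟩
  have hθ := H.indexFormula_le_iff_succ.1 (hn m (Nat.lt_succ_self m))
  induction hj' : m - j generalizing j with
  | zero =>
    obtain rfl : j = m := by omega
    rw [potential_of_le le_rfl]
    field_simp
    linarith
  | succ k ih =>
    refine le_trans ?_ (ih (j := j + 1) (by omega) (by omega))
    rw [potential_of_lt (show j + 1 < m + 1 by omega)]
    refine mul_le_mul_of_nonneg_left ?_ hρ.le
    have h1 : b (j + 1) ≤ b (m + 1) := H.strictMono.monotone (by omega)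
    have h2 := H.le_mul_active (m + 1)
    linarith

/-- The counterpart for activity: above the threshold the potential is `β` plus a constant, so the
state `n` is the critical one. -/
lemma le_potential_succ (hn : W ≤ indexFormula ρ b β n) {j : ℕ} (hj : n ≤ j) :
    W ≤ ρ * potential ρ b β 1 W n (j + 1) := by
  have hρ := H.pos
  have hθ : gain ρ b β 1 W n ≤ ρ * β (n + 1) := by
    rcases hn.lt_or_eq with h | h
    · exact (not_le.1 fun h' => not_le.2 h (H.indexFormula_le_iff.2 h')).le
    · rw [gain, div_le_iff₀ (by positivity), h, indexFormula]
      field_simp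
      linarith
  have h1 : β (n + 1) ≤ β (j + 1) := H.strictMono_active.monotone (by omega)
  have h2 := mul_le_mul_of_nonneg_left h1 hρ.le
  rw [potential_of_le (by omega), mul_add, mul_div_cancel₀ _ hρ.ne']
  linarith

lemma bellman_equation (hlo : ∀ m, m < n → indexFormula ρ b β m ≤ W)
    (hhi : W ≤ indexFormula ρ b β n) (j : ℕ) :
    gain ρ b β 1 W n + potential ρ b β 1 W n j =
      min (b j + potential ρ b β 1 W n (j + 1))
        (b j + W + ρ * potential ρ b β 1 W n 0 + (1 - ρ) * potential ρ b β 1 W n (j + 1)) := by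
  have hρ := H.pos
  rw [potential_zero hρ]
  by_cases hj : j < n
  · have h1 := H.potential_succ_le hlo hj
    rw [min_eq_left (by linarith), potential_of_lt hj]
    ring
  · have hj' := not_lt.1 hj
    have h1 := H.le_potential_succ hhi hj'
    rw [min_eq_right (by linarith), potential_of_le hj', potential_of_le (by omega), H.eq_add j]
    field_simp
    ring

lemma bellman_subsolution (hlo : ∀ m, m < n → indexFormula ρ b β m ≤ W)
    (hhi : W ≤ indexFormula ρ b β n) (j : ℕ) (a : Bool) :
    gain ρ b β 1 W n + potential ρ b β 1 W n j ≤
      b j + W * (if a then 1 else 0) + expect (step ρ j a) (potential ρ b β 1 W n) := by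
  rw [H.bellman_equation hlo hhi]
  cases a
  · rw [expect_step_false]
    exact (min_le_left _ _).trans (by simp)
  · rw [expect_step_true]
    exact (min_le_right _ _).trans (le_of_eq (by simp; ring))

/-- The threshold policy attains the value; the Bellman solution is a subsolution for every action,
hence a lower bound for every causal policy. -/
lemma optimalValue_eq (hlo : ∀ m, m < n → indexFormula ρ b β m ≤ W)
    (hhi : W ≤ indexFormula ρ b β n) (i : ℕ) :
    optimalValue b ρ W i = (gain ρ b β 1 W n : EReal) := by
  refine le_antisymm ?_ (le_iInf fun φ => ?_)
  · rw [← H.averageCost_threshold W n i]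
    exact iInf_le _ _
  · obtain ⟨c, k, hc, hV⟩ := H.exists_potential_le W n
    exact le_averageCost_of_subsolution
      (fun _ j a _ => H.bellman_subsolution hlo hhi j a) hc hV i

lemma isOptimal_threshold (hlo : ∀ m, m < n → indexFormula ρ b β m ≤ W)
    (hhi : W ≤ indexFormula ρ b β n) : IsOptimal b ρ W (threshold n) := fun i => by
  rw [H.averageCost_threshold, H.optimalValue_eq hlo hhi]

lemma bddBelow_potential : BddBelow (Set.range (potential ρ b β 1 W n)) := by
  have hρ := H.pos
  refine ⟨-(∑ i ∈ Finset.range n, |1 * b i - gain ρ b β 1 W n|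
    + |(W - gain ρ b β 1 W n) / ρ|), ?_⟩
  rintro _ ⟨j, rfl⟩
  have h1 : |∑ i ∈ Finset.Ico j n, (1 * b i - gain ρ b β 1 W n)| ≤
      ∑ i ∈ Finset.range n, |1 * b i - gain ρ b β 1 W n| :=
    (Finset.abs_sum_le_sum_abs _ _).trans (Finset.sum_le_sum_of_subset_of_nonneg
      (fun i hi => Finset.mem_range.2 (Finset.mem_Ico.1 hi).2) fun _ _ _ => abs_nonneg _)
  have h2 := neg_abs_le (∑ i ∈ Finset.Ico j n, (1 * b i - gain ρ b β 1 W n))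
  have h3 := neg_abs_le ((W - gain ρ b β 1 W n) / ρ)
  have h4 := H.active_nonneg (max j n)
  rw [potential]
  linarith

lemma isBellmanSolution (hlo : ∀ m, m < n → indexFormula ρ b β m ≤ W)
    (hhi : W ≤ indexFormula ρ b β n) :
    IsBellmanSolution b ρ W (gain ρ b β 1 W n) (potential ρ b β 1 W n) :=
  ⟨H.optimalValue_eq hlo hhi, H.bddBelow_potential, H.bellman_equation hlo hhi⟩

end Threshold

/-! ### Where the passive action attains the minimum in the Bellman equation -/

/-- A solution of the Bellman equation that is bounded below dominates, from
the state `n` on, the cost of staying active, when that cost favours activity in these states. -/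
lemma active_le_of_bellman {W θ : ℝ} {V : ℕ → ℝ} (hbdd : BddBelow (Set.range V))
    (hV : ∀ j, θ + V j = min (b j + V (j + 1)) (b j + W + ρ * V 0 + (1 - ρ) * V (j + 1)))
    {n : ℕ} (hθ : θ < ρ * β n) {j : ℕ} (hj : n ≤ j) :
    β j + (W - θ) / ρ + V 0 ≤ V j := by
  have hρ := H.pos
  have hρ1 := sub_nonneg.2 ρ.2.2
  obtain ⟨K, hK⟩ := hbdd
  have hK' : ∀ j, K ≤ V j := fun j => hK ⟨j, rfl⟩
  set U : ℕ → ℝ := fun j => β j + (W - θ) / ρ + V 0 with hU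
  have hUrec : ∀ j, θ + U j = b j + W + ρ * V 0 + (1 - ρ) * U (j + 1) := by
    intro j
    simp only [hU]
    rw [H.eq_add j]
    field_simp
    ring
  have hactive : ∀ j, W + ρ * V 0 ≤ ρ * V (j + 1) →
      θ + V j = b j + W + ρ * V 0 + (1 - ρ) * V (j + 1) := by
    intro j h
    rw [hV j, min_eq_right (by linarith)]
  have hlow : ∀ j, b j + (min K (W + ρ * V 0 + (1 - ρ) * K) - θ) ≤ V j := by
    intro j
    have h1 := mul_le_mul_of_nonneg_left (hK' (j + 1)) hρ1
    have h2 : b j + min K (W + ρ * V 0 + (1 - ρ) * K) ≤ θ + V j := by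
      rw [hV j]
      refine le_min ?_ ?_
      · linarith [min_le_left K (W + ρ * V 0 + (1 - ρ) * K), hK' (j + 1)]
      · linarith [min_le_right K (W + ρ * V 0 + (1 - ρ) * K)]
    linarith
  have htend : Tendsto V atTop atTop :=
    tendsto_atTop_mono hlow (tendsto_atTop_add_const_right _ _ H.tendsto)
  obtain ⟨J, hJ⟩ := eventually_atTop.1 (htend.eventually_ge_atTop ((W + ρ * V 0) / ρ))
  have hJ' : ∀ j, J ≤ j → W + ρ * V 0 ≤ ρ * V (j + 1) := by
    intro j hj
    have := hJ (j + 1) (by omega)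
    rw [div_le_iff₀ hρ] at this
    linarith
  obtain ⟨A, r, hA, hr0, hr1, hdrift⟩ := H.exists_drift
  -- Far out `V` is so large that activity is optimal, so `U - V` at `j` is `1 - ρ` times its value
  -- at `j + 1`. Iterating with the drift of `β + A` and the lower bound on `V` forces `U - V ≤ 0`.
  have hfar : ∀ j, J ≤ j → U j ≤ V j := by
    set c : ℝ := 1 + |(W - θ) / ρ + V 0 - K| with hc
    have hc0 : 0 ≤ c := by positivity
    have hgeom : ∀ m j, J ≤ j → U j - V j ≤ c * r ^ m * (β j + A) := by
      intro m
      induction m with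
      | zero =>
        intro j _
        have h1 := hK' j
        have h2 := le_abs_self ((W - θ) / ρ + V 0 - K)
        have h3 := H.active_nonneg j
        have h4 : |(W - θ) / ρ + V 0 - K| * 1 ≤ |(W - θ) / ρ + V 0 - K| * (β j + A) :=
          mul_le_mul_of_nonneg_left (by linarith) (abs_nonneg _)
        simp only [hU, hc, pow_zero]
        linarith
      | succ m ih =>
        intro j hj
        have h1 := hUrec j
        have h2 := hactive j (hJ' j hj)
        have h3 := mul_le_mul_of_nonneg_left (ih (j + 1) (by omega)) hρ1
        have h4 := mul_le_mul_of_nonneg_left (hdrift j) (show 0 ≤ c * r ^ m by positivity)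
        rw [pow_succ]
        linarith
    intro j hj
    have hlim : Tendsto (fun m : ℕ => c * r ^ m * (β j + A)) atTop (nhds 0) := by
      simpa using ((tendsto_pow_atTop_nhds_zero_of_lt_one hr0 hr1).const_mul c).mul_const (β j + A)
    have := ge_of_tendsto' hlim fun m => hgeom m j hj
    linarith
  -- Downward induction from `J`: `θ < ρ * β n` gives `W + ρ * V 0 < ρ * U (j + 1)`, so `U ≤ V` at
  -- `j + 1` makes activity optimal at `j` as well.
  have hback : ∀ m j, n ≤ j → J ≤ j + m → U j ≤ V j := by
    intro m
    induction m with
    | zero => exact fun j _ h => hfar j h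
    | succ m ih =>
      intro j hj hm
      have h1 : U (j + 1) ≤ V (j + 1) := ih (j + 1) (by omega) (by omega)
      have h2 : β n ≤ β (j + 1) := H.strictMono_active.monotone (by omega)
      have h3 := mul_le_mul_of_nonneg_left h2 hρ.le
      have h4 := mul_le_mul_of_nonneg_left h1 hρ.le
      have h5 : ρ * U (j + 1) = ρ * β (j + 1) + (W - θ) + ρ * V 0 := by
        simp only [hU]
        rw [mul_add, mul_add, mul_div_cancel₀ _ hρ.ne']
      have h6 := hactive j (by linarith)
      have h7 := hUrec j
      have h8 := mul_le_mul_of_nonneg_left h1 hρ1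
      linarith
  exact hback J j hj (by omega)

lemma mem_bellmanPassiveSet_iff (hw : Tendsto (indexFormula ρ b β) atTop atTop) (W : ℝ) (n : ℕ) :
    n ∈ bellmanPassiveSet b ρ W ↔ indexFormula ρ b β n ≤ W := by
  have hρ := H.pos
  constructor
  · rintro ⟨θ, V, ⟨hopt, hbdd, hV⟩, hpass⟩
    -- Otherwise the comparison at `n + 1` makes passivity at `n` strictly worse. No uniqueness of
    -- `V` is needed: `θ`, being optimal, is at most the gain of the threshold `n`.
    have hθ : ρ * β (n + 1) ≤ θ := by
      by_contra hlt
      rw [not_le] at hlt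
      have h1 := H.active_le_of_bellman hbdd hV hlt le_rfl
      have h2 := mul_le_mul_of_nonneg_left h1 hρ.le
      rw [mul_add, mul_add, mul_div_cancel₀ _ hρ.ne'] at h2
      linarith
    rw [H.indexFormula_le_iff]
    refine hθ.trans (EReal.coe_le_coe_iff.1 ?_)
    rw [← hopt 0, ← H.averageCost_threshold W n 0]
    exact iInf_le _ _
  · intro hn
    obtain ⟨N, hN, hlo⟩ := exists_threshold hw W
    have hnN : n < N := H.strictMono_indexFormula.lt_iff_lt.1 (hn.trans_lt hN)
    refine ⟨_, _, H.isBellmanSolution hlo hN.le, ?_⟩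
    have := H.potential_succ_le hlo hnN
    rw [potential_zero hρ]
    linarith

/-! ### Where optimal stationary policies are passive -/

/-- A stationary policy that is passive in a state above the optimal threshold is not optimal. -/
lemma exists_lt_averageCost (hρ1 : (ρ : ℝ) < 1) {W : ℝ} {n N : ℕ}
    (hlo : ∀ m, m < N → indexFormula ρ b β m ≤ W) (hhi : W < indexFormula ρ b β N)
    (hn : N ≤ n) {f : ℕ → Bool} (hf : f n = false) (i : ℕ) :
    (gain ρ b β 1 W N : EReal) < averageCost b ρ W (stationary f) i := by
  have hρ := H.pos
  have hq0 : (0 : ℝ) < 1 - ρ := by linarith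
  set θ := gain ρ b β 1 W N with hθdef
  set V := potential ρ b β 1 W N with hVdef
  set q : ℝ := 1 / (1 - ρ) with hq
  have hqmul : (1 - ρ) * q = 1 := by rw [hq]; field_simp
  have hq1 : 1 ≤ q := by rw [hq, le_div_iff₀ hq0]; linarith
  set δ : ℝ := ρ * β (n + 1) - θ with hδdef
  have hδ : 0 < δ := by
    have h1 : θ < ρ * β (N + 1) :=
      not_le.1 fun h => not_le.2 hhi (H.indexFormula_le_iff.2 h)
    have h2 : β (N + 1) ≤ β (n + 1) := H.strictMono_active.monotone (by omega)
    have h3 := mul_le_mul_of_nonneg_left h2 hρ.le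
    linarith
  -- Chosen so that the slack `δ` of a passive action at `n` pays exactly for the gain increase `ε`
  -- and the drop of `u` from `ε / ρ * q ^ n` to 0.
  set ε : ℝ := δ / (1 + q ^ n / ρ) with hε
  have hden : 0 < 1 + q ^ n / ρ := by positivity
  have hε0 : 0 < ε := by positivity
  have hεδ : ε + ε / ρ * q ^ n = δ := by
    rw [hε]
    field_simp
  have hslack : ∀ j, n ≤ j → θ + V j + δ ≤ b j + V (j + 1) := by
    intro j hj
    have h1 : β (n + 1) ≤ β (j + 1) := H.strictMono_active.monotone (by omega)
    have h2 := mul_le_mul_of_nonneg_left h1 hρ.le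
    have h3 : θ + V j + (ρ * β (j + 1) - θ) = b j + V (j + 1) := by
      rw [hVdef, potential_of_le (by omega), potential_of_le (by omega), H.eq_add j, ← hθdef]
      ring
    linarith
  -- For active steps from `j ≠ n` the correction satisfies `ε + u j = ρ * u 0 + (1 - ρ) * u (j +
  -- 1)`; for passive steps below `n` it grows by at least `ε`. The jump at `n` is harmless because
  -- `f` is passive there.
  set u : ℕ → ℝ := fun j => if j ≤ n then ε / ρ * q ^ j else 0 with hu
  have hεq : ∀ j : ℕ, 0 ≤ ε / ρ * q ^ j := fun j => by positivity
  have hu_le : ∀ j, u j ≤ ε / ρ * q ^ n := by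
    intro j
    simp only [hu]
    split_ifs with h
    · exact mul_le_mul_of_nonneg_left (pow_le_pow_right₀ hq1 h) (by positivity)
    · exact hεq n
  have hu0 : ρ * u 0 = ε := by
    simp only [hu, Nat.zero_le, if_true, pow_zero]
    field_simp
  have hsub : ∀ l j a, stationary f l j a ≠ 0 → θ + ε + (V j + u j) ≤
      b j + W * (if a then 1 else 0) + expect (step ρ j a) fun j => V j + u j := by
    intro l j a ha
    have hbell := H.bellman_subsolution hlo hhi.le j a
    rw [← hθdef, ← hVdef] at hbell
    rw [expect_add (finite_support_step _ _ _)]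
    have ha' := stationary_apply_ne_zero ha
    cases a with
    | true =>
      have hjn : j ≠ n := by
        rintro rfl
        rw [hf] at ha'
        exact Bool.noConfusion ha'
      have h1 : (1 - ρ) * u (j + 1) = u j := by
        simp only [hu]
        rcases lt_or_gt_of_ne hjn with h | h
        · rw [if_pos (by omega), if_pos h.le, pow_succ]
          linear_combination (ε / ρ * q ^ j) * hqmul
        · rw [if_neg (by omega), if_neg (by omega), mul_zero]
      rw [expect_step_true ρ j u]
      linarith
    | false =>
      rw [expect_step_false] at hbell ⊢
      rw [expect_step_false]
      simp only [Bool.false_eq_true, if_false, mul_zero, add_zero] at hbell ⊢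
      rcases lt_or_ge j n with h | h
      · have h1 : ε + u j ≤ u (j + 1) := by
          simp only [hu]
          rw [if_pos h.le, if_pos (show j + 1 ≤ n by omega)]
          have h2 : ε / ρ * q ^ (j + 1) - ε / ρ * q ^ j = ε * q ^ (j + 1) := by
            have h3 : q - 1 = ρ * q := by linarith
            rw [pow_succ]
            calc _ = ε / ρ * q ^ j * (q - 1) := by ring
              _ = _ := by
                rw [h3]
                field_simp
          have h3 : ε * 1 ≤ ε * q ^ (j + 1) :=
            mul_le_mul_of_nonneg_left (one_le_pow₀ hq1) hε0.le
          linarith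
        linarith
      · have h1 := hslack j h
        have h2 : u (j + 1) = 0 := by
          simp only [hu]
          rw [if_neg (by omega)]
        have h3 := hu_le j
        linarith
  obtain ⟨c, k, hc, hV⟩ := H.exists_potential_le W N
  have hle := le_averageCost_of_subsolution hsub hc (k := k + ε / ρ * q ^ n)
    (fun j => by linarith [hV j, hu_le j]) i
  exact lt_of_lt_of_le (EReal.coe_lt_coe_iff.2 (by linarith)) hle

lemma mem_passiveSet_iff (hw : Tendsto (indexFormula ρ b β) atTop atTop) (hρ1 : (ρ : ℝ) < 1)
    (W : ℝ) (n : ℕ) : n ∈ passiveSet b ρ W ↔ indexFormula ρ b β n ≤ W := by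
  obtain ⟨N, hN, hlo⟩ := exists_threshold hw W
  constructor
  · rintro ⟨f, hopt, hf⟩
    by_contra hlt
    have hNn : N ≤ n := not_lt.1 fun h => hlt (hlo n h)
    have h1 := H.exists_lt_averageCost hρ1 hlo hN hNn hf 0
    rw [hopt 0, H.optimalValue_eq hlo hN.le] at h1
    exact lt_irrefl _ h1
  · intro hn
    have hnN : n < N := H.strictMono_indexFormula.lt_iff_lt.1 (hn.trans_lt hN)
    exact ⟨_, H.isOptimal_threshold hlo hN.le, by simpa using hnN⟩

end IsActiveCost

lemma isWhittleIndex_of_mem_iff {D : ℝ → Set ℕ} {w : ℕ → ℝ}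
    (h : ∀ W n, n ∈ D W ↔ w n ≤ W) : IsWhittleIndex D w :=
  ⟨fun W' W hlt n hn => (h W n).2 (((h W' n).1 hn).trans hlt.le),
    fun n => ⟨(h _ n).2 le_rfl, fun W hW => (h W n).1 hW⟩⟩

lemma IsActiveCost.whittleIndex {ρ : unitInterval} {b β w : ℕ → ℝ} (H : IsActiveCost ρ b β)
    (hw : ∀ n, w n = indexFormula ρ b β n) (hle : ∃ c, 0 < c ∧ ∀ n : ℕ, c * n ≤ w n) :
    IsWhittleIndex (bellmanPassiveSet b ρ) w ∧
      ((ρ : ℝ) < 1 → IsWhittleIndex (passiveSet b ρ) w) ∧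
      IsThresholdIntersection b ρ w ∧ StrictMono w := by
  obtain ⟨c, hc, hle⟩ := hle
  obtain rfl : w = indexFormula ρ b β := funext hw
  have htend : Tendsto (indexFormula ρ b β) atTop atTop :=
    tendsto_atTop_mono hle (tendsto_natCast_atTop_atTop.const_mul_atTop hc)
  exact ⟨isWhittleIndex_of_mem_iff (H.mem_bellmanPassiveSet_iff htend),
    fun hρ1 => isWhittleIndex_of_mem_iff (H.mem_passiveSet_iff htend hρ1),
    H.isThresholdIntersection, H.strictMono_indexFormula⟩

/-! ### The two penalties -/

lemma expect_sourceDisplacement (p : unitInterval) (d : ℝ) (u : ℕ) :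
    (sourceDisplacement p u).support.Finite ∧
      expect (sourceDisplacement p u) (fun x => (x : ℝ) * d) = u * p * d := by
  induction u with
  | zero => exact ⟨finite_support_pure _, by simp [sourceDisplacement, expect_pure]⟩
  | succ u ih =>
    have hm : ∀ x : ℕ, ((coin p).map fun move => if move then x + 1 else x).support.Finite :=
      fun x => finite_support_map _ (finite_support_bool _)
    refine ⟨finite_support_bind ih.1 hm, ?_⟩
    rw [sourceDisplacement, expect_bind ih.1 hm]
    have h1 : ∀ x : ℕ, expect ((coin p).map fun move => if move then x + 1 else x)
        (fun y : ℕ => (y : ℝ) * d) = (x : ℝ) * d + p * d := by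
      intro x
      rw [expect_map (finite_support_bool _), expect_coin]
      simp only [Bool.false_eq_true, if_true, if_false]
      push_cast
      ring
    simp only [h1]
    rw [expect_add ih.1, ih.2, expect_const ih.1]
    push_cast
    ring

lemma aoii_eq (p : unitInterval) (d : ℝ) (j : ℕ) : aoii p d j = d * p * (j * (j + 1) / 2) := by
  unfold aoii
  induction j with
  | zero => simp [(expect_sourceDisplacement p d 0).2]
  | succ j ih =>
    rw [Finset.sum_range_succ, ih, (expect_sourceDisplacement p d (j + 1)).2]
    push_cast
    ring

lemma sum_range_cast (n : ℕ) : ∑ k ∈ Finset.range n, (k : ℝ) = n * (n - 1) / 2 := by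
  induction n with
  | zero => simp
  | succ n ih =>
    rw [Finset.sum_range_succ, ih]
    push_cast
    ring

lemma sum_range_aoii (p : unitInterval) (d : ℝ) (n : ℕ) :
    ∑ k ∈ Finset.range n, aoii p d k = d * p * ((n - 1) * n * (n + 1) / 6) := by
  induction n with
  | zero => simp
  | succ n ih =>
    rw [Finset.sum_range_succ, ih, aoii_eq]
    push_cast
    ring

/-- The expected age of information until the next delivery, when staying active. -/
noncomputable def aoiActive (ρ : unitInterval) (j : ℕ) : ℝ := j / ρ + (1 - ρ) / (ρ : ℝ) ^ 2

lemma isActiveCost_aoi {ρ : unitInterval} (hρ : 0 < (ρ : ℝ)) :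
    IsActiveCost ρ aoi (aoiActive ρ) where
  pos := hρ
  nonneg j := Nat.cast_nonneg j
  strictMono := Nat.strictMono_cast
  tendsto := tendsto_natCast_atTop_atTop
  eq_add j := by
    simp only [aoi, aoiActive]
    push_cast
    field_simp
    ring
  strictMono_active := by
    refine strictMono_nat_of_lt_succ fun j => ?_
    have h : aoiActive ρ (j + 1) - aoiActive ρ j = 1 / ρ := by
      simp only [aoiActive]
      push_cast
      ring
    have : 0 < 1 / (ρ : ℝ) := by positivity
    linarith
  le_mul_add := by
    have := sub_nonneg.2 ρ.2.2
    refine ⟨1 / ρ, (1 - ρ) / (ρ : ℝ) ^ 2, ?_, by positivity, fun j => ?_⟩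
    · rw [le_div_iff₀ hρ]
      linarith
    · simp only [aoi, aoiActive]
      exact le_of_eq (by ring)

/-- The expected distance-based age of incorrect information until the next delivery, when staying
active. -/
noncomputable def aoiiActive (ρ p : unitInterval) (d : ℝ) (j : ℕ) : ℝ :=
  d * p * ((j : ℝ) ^ 2 / (2 * ρ) + (1 / (2 * ρ) + (1 - ρ) / (ρ : ℝ) ^ 2) * j
    + (1 - ρ) / (ρ : ℝ) ^ 3)

lemma isActiveCost_aoii {ρ p : unitInterval} {d : ℝ} (hρ : 0 < (ρ : ℝ)) (hp : 0 < (p : ℝ))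
    (hd : 0 < d) : IsActiveCost ρ (aoii p d) (aoiiActive ρ p d) where
  pos := hρ
  nonneg j := by
    rw [aoii_eq]
    positivity
  strictMono := by
    refine strictMono_nat_of_lt_succ fun j => ?_
    have h : aoii p d (j + 1) - aoii p d j = d * p * (j + 1) := by
      rw [aoii_eq, aoii_eq]
      push_cast
      ring
    have : 0 < d * p * ((j : ℝ) + 1) := by positivity
    linarith
  tendsto := by
    refine tendsto_atTop_mono (f := fun j : ℕ => d * p / 2 * (j : ℝ)) (fun j => ?_)
      (tendsto_natCast_atTop_atTop.const_mul_atTop (by positivity))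
    have h : aoii p d j - d * p / 2 * j = d * p / 2 * (j : ℝ) ^ 2 := by
      rw [aoii_eq]
      ring
    have : 0 ≤ d * p / 2 * (j : ℝ) ^ 2 := by positivity
    linarith
  eq_add j := by
    rw [aoii_eq]
    simp only [aoiiActive]
    push_cast
    field_simp
    ring
  strictMono_active := by
    have := sub_nonneg.2 ρ.2.2
    refine strictMono_nat_of_lt_succ fun j => ?_
    have h : aoiiActive ρ p d (j + 1) - aoiiActive ρ p d j =
        d * p * ((2 * j + 1) / (2 * ρ) + (1 / (2 * ρ) + (1 - ρ) / (ρ : ℝ) ^ 2)) := by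
      simp only [aoiiActive]
      push_cast
      ring
    have : 0 < d * p * ((2 * (j : ℝ) + 1) / (2 * ρ) + (1 / (2 * ρ) + (1 - ρ) / (ρ : ℝ) ^ 2)) := by
      positivity
    linarith
  le_mul_add := by
    have hρ1 := sub_nonneg.2 ρ.2.2
    -- The penalty is `d * p * (j ^ 2 + j) / 2`, so twice the sum of the coefficients `1 / ρ` and
    -- `(1 - ρ) / ρ ^ 2` dominates the quadratic and linear terms of `β`; the constant term is left
    -- over.
    refine ⟨2 / ρ + 2 * ((1 - ρ) / (ρ : ℝ) ^ 2), d * p * ((1 - ρ) / (ρ : ℝ) ^ 3), ?_,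
      by positivity, fun j => ?_⟩
    · have h1 : 1 ≤ 2 / (ρ : ℝ) := by
        rw [le_div_iff₀ hρ]
        linarith
      have h2 : 0 ≤ (1 - ρ) / (ρ : ℝ) ^ 2 := by positivity
      linarith
    · have h : (2 / ρ + 2 * ((1 - ρ) / (ρ : ℝ) ^ 2)) * aoii p d j
          + d * p * ((1 - ρ) / (ρ : ℝ) ^ 3) - aoiiActive ρ p d j =
          d * p * ((j : ℝ) ^ 2 / (2 * ρ) + j / (2 * ρ) + (1 - ρ) / (ρ : ℝ) ^ 2 * (j : ℝ) ^ 2) := by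
        rw [aoii_eq, aoiiActive]
        ring
      have : 0 ≤ d * p * ((j : ℝ) ^ 2 / (2 * ρ) + j / (2 * ρ)
          + (1 - ρ) / (ρ : ℝ) ^ 2 * (j : ℝ) ^ 2) := by positivity
      linarith

end WhittleAge

theorem theorem2 (ρ p : unitInterval) (d : ℝ)
    (hρ : 0 < (ρ : ℝ)) (hp : 0 < (p : ℝ)) (hd : 0 < d)
    (wAoI wAoII : ℕ → ℝ)
    (hwAoI : ∀ n : ℕ, wAoI n = (n : ℝ) * (n + 1) * ρ / 2 + n + 1)
    (hwAoII : ∀ n : ℕ, wAoII n = d * p *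
      ((1 / 3) * ρ * (n : ℝ) ^ 3 + (1 + ρ / 2) * (n : ℝ) ^ 2
        + (1 + ρ / 6 + 1 / ρ) * n + 1 / ρ)) :
    -- the age of information
    (WhittleAge.IsWhittleIndex (WhittleAge.bellmanPassiveSet WhittleAge.aoi ρ) wAoI ∧
      ((ρ : ℝ) < 1 → WhittleAge.IsWhittleIndex (WhittleAge.passiveSet WhittleAge.aoi ρ) wAoI) ∧
      WhittleAge.IsThresholdIntersection WhittleAge.aoi ρ wAoI ∧
      StrictMono wAoI) ∧
    -- the distance-based age of incorrect information
    (WhittleAge.IsWhittleIndex (WhittleAge.bellmanPassiveSet (WhittleAge.aoii p d) ρ) wAoII ∧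
      ((ρ : ℝ) < 1 →
        WhittleAge.IsWhittleIndex (WhittleAge.passiveSet (WhittleAge.aoii p d) ρ) wAoII) ∧
      WhittleAge.IsThresholdIntersection (WhittleAge.aoii p d) ρ wAoII ∧
      StrictMono wAoII) := by
  refine ⟨(WhittleAge.isActiveCost_aoi hρ).whittleIndex (fun n => ?_)
      ⟨1, one_pos, fun n => ?_⟩,
    (WhittleAge.isActiveCost_aoii hρ hp hd).whittleIndex (fun n => ?_)
      ⟨d * p, by positivity, fun n => ?_⟩⟩
  · rw [hwAoI, WhittleAge.indexFormula, WhittleAge.cycleCost]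
    simp only [WhittleAge.aoi, WhittleAge.aoiActive]
    rw [WhittleAge.sum_range_cast]
    push_cast
    field_simp
    ring
  · have : 0 ≤ (n : ℝ) * (n + 1) * ρ / 2 := by positivity
    rw [hwAoI]
    linarith
  · rw [hwAoII, WhittleAge.indexFormula, WhittleAge.cycleCost, WhittleAge.sum_range_aoii]
    simp only [WhittleAge.aoiiActive]
    push_cast
    field_simp
    ring
  · rw [hwAoII]
    refine mul_le_mul_of_nonneg_left ?_ (by positivity)
    have : 0 ≤ (1 / 3) * ρ * (n : ℝ) ^ 3 + (1 + ρ / 2) * (n : ℝ) ^ 2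
        + (ρ / 6 + 1 / ρ) * n + 1 / ρ := by positivity
    linarith
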